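/- Let $n\ge 2$ and $k\ge 1$ be integers. Given a convex polygon in the plane with $n+1$ labelled edges, let $D_{n+1,k-1}$ be the number of its dissections by $k-1$ diagonals, that is, of the sets of $k-1$ diagonals (segments joining two non-adjacent vertices) such that no two of the diagonals intersect in their interior; because the edges are labelled, dissections that differ by a symmetry of the polygon are counted separately. Then $$D_{n+1,k-1}=\frac1k\binom{n-2}{k-1}\binom{n+k-1}{k-1}.$$ Moreover, $D_{n+1,k-1}$ is equal to the number of parenthesizations of the list $1,2,\dots,n$ with $k$ pairs of parentheses. Here a parenthesization is a set of pairs of parentheses inserted in the list, each enclosing at least two (consecutive) entries of the list, such that any two pairs are nested or disjoint, distinct pairs enclose distinct sets of entries, and the maximal pair, enclosing the whole list, is included. -/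

import Mathlib

namespace KirkmanCayley

/-- The Euclidean plane. -/
abbrev Plane : Type := EuclideanSpace ℝ (Fin 2)

/-- Twice the signed area of the triangle `a b c`; it is positive exactly when `c` lies strictly
to the left of the line from `a` to `b`. -/
def orient (a b c : Plane) : ℝ :=
  (b 0 - a 0) * (c 1 - a 1) - (b 1 - a 1) * (c 0 - a 0)

/-- `v 0, v 1, …, v n` are the vertices, listed counterclockwise, of a convex polygon with the
`n + 1` sides `v i v (i + 1)` (the index is cyclic: the last side joins `v n` to `v 0`): every
vertex that is not an end point of a side lies strictly to the left of that side. -/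
def IsConvexPolygon {n : ℕ} (v : Fin (n + 1) → Plane) : Prop :=
  ∀ i m : Fin (n + 1), m ≠ i → m ≠ i + 1 → 0 < orient (v i) (v (i + 1)) (v m)

/-- The pair `(i, j)` of vertex indices stands for a diagonal of the polygon: the two vertices are
distinct and not adjacent. Taking `i < j`, every diagonal is represented exactly once. -/
def IsDiagonal {n : ℕ} (d : Fin (n + 1) × Fin (n + 1)) : Prop :=
  d.1 < d.2 ∧ d.2 ≠ d.1 + 1 ∧ d.1 ≠ d.2 + 1

/-- The interior of the diagonal `d` of the polygon with vertices `v`. -/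
def diagonalInterior {n : ℕ} (v : Fin (n + 1) → Plane) (d : Fin (n + 1) × Fin (n + 1)) :
    Set Plane :=
  openSegment ℝ (v d.1) (v d.2)

/-- A dissection of the polygon with vertices `v`: a set of diagonals no two of which intersect
in their interior. -/
def IsDissection {n : ℕ} (v : Fin (n + 1) → Plane)
    (S : Finset (Fin (n + 1) × Fin (n + 1))) : Prop :=
  (∀ d ∈ S, IsDiagonal d) ∧
    ∀ d ∈ S, ∀ e ∈ S, d ≠ e → Disjoint (diagonalInterior v d) (diagonalInterior v e)

/-- The number of dissections, by exactly `r` diagonals, of the polygon with vertices `v`. As the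
edges are labelled, dissections are not identified under symmetries. -/
noncomputable def numDissections {n : ℕ} (v : Fin (n + 1) → Plane) (r : ℕ) : ℕ :=
  {S : Finset (Fin (n + 1) × Fin (n + 1)) | IsDissection v S ∧ S.card = r}.ncard

/-- The entries (given by their positions in a list with `n` entries) that are enclosed by the
pair of parentheses `p`, which opens just before entry `p.1` and closes just after entry `p.2`. -/
def enclosed {n : ℕ} (p : Fin n × Fin n) : Finset (Fin n) :=
  Finset.Icc p.1 p.2

/-- A parenthesization of a list with `n` entries: a set of pairs of parentheses, each enclosing
at least two entries, which contains the maximal pair (the one enclosing the whole list), and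
any two of which are nested or disjoint. -/
def IsParenthesization {n : ℕ} (S : Finset (Fin n × Fin n)) : Prop :=
  (∀ p ∈ S, 2 ≤ (enclosed p).card) ∧
    (∃ p ∈ S, enclosed p = Finset.univ) ∧
      ∀ p ∈ S, ∀ q ∈ S,
        enclosed p ⊆ enclosed q ∨ enclosed q ⊆ enclosed p ∨ Disjoint (enclosed p) (enclosed q)

/-- The number of parenthesizations of the list `1, …, n` with exactly `k` pairs of
parentheses. -/
noncomputable def numParenthesizations (n k : ℕ) : ℕ :=
  {S : Finset (Fin n × Fin n) | IsParenthesization S ∧ S.card = k}.ncard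

end KirkmanCayley

namespace KirkmanCayley

/-! Both objects become sets of noncrossing arcs on `[0, n]`: a diagonal joins two vertices, a pair
of parentheses joins two gaps of the list. The side `(0, n)` is a permitted arc, but not a diagonal,
whereas the maximal pair must be present. An arc set contains `(0, n)` exactly when it has a single
break, so dissections are the sets of `k - 1` arcs with at least two breaks and parenthesizations
the sets of `k` arcs with exactly one.

The engine is `card_arcSets_succ`. If no arc starts at the left end `a`, the interval shrinks to `[a
+ 1, N]` and one break is lost. Otherwise the longest arc at `a` is erased, which uncovers at least
one more break; it is recovered from the number of breaks it left visible. For one break the first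
case is void, and this already equates the two counts.

The recurrence determines all the numbers. With `L = N - a`, there are `m / (L + j) * C(L + j, j) *
C(L - m - 1, j - 1)` sets of `j ≥ 1` arcs with exactly `m < L` breaks
(`card_arcSets_of_card_arcSetsGE`); summation over `m` gives `card_arcSetsGE_eq`, and the case of at
least two breaks is the theorem.

Geometry enters only through `IsConvexPolygon.orient_pos`: increasing vertex triples are
counterclockwise, so diagonals meet in their interiors exactly when their indices interlace. -/

/-! ### Noncrossing arc sets and their breaks -/

/-- `F` is a set of pairwise noncrossing arcs `(i, j)` with `a ≤ i`, `i + 2 ≤ j` and `j ≤ N`. -/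
structure IsNoncrossing (a N : ℕ) (F : Finset (ℕ × ℕ)) : Prop where
  bounds : ∀ p ∈ F, a ≤ p.1 ∧ p.1 + 2 ≤ p.2 ∧ p.2 ≤ N
  nested : ∀ p ∈ F, ∀ q ∈ F, p.1 < q.1 → q.1 < p.2 → q.2 ≤ p.2

/-- The points of `(a, N]` lying strictly below no arc of `F`. Their number is the number of
top-level components into which `F` splits the interval `[a, N]`. -/
def breaks (a N : ℕ) (F : Finset (ℕ × ℕ)) : Finset ℕ :=
  {b ∈ Finset.Ioc a N | ∀ p ∈ F, b ≤ p.1 ∨ p.2 ≤ b}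

open Classical in
/-- The sets of `k` noncrossing arcs on `[a, N]` with at least `m` components. -/
noncomputable def arcSetsGE (N a k m : ℕ) : Finset (Finset (ℕ × ℕ)) :=
  {F ∈ (Finset.range (N + 1) ×ˢ Finset.range (N + 1)).powerset |
    IsNoncrossing a N F ∧ F.card = k ∧ m ≤ (breaks a N F).card}

/-- The sets of `k` noncrossing arcs on `[a, N]` with exactly `m` components. -/
noncomputable def arcSets (N a k m : ℕ) : Finset (Finset (ℕ × ℕ)) :=
  {F ∈ arcSetsGE N a k m | (breaks a N F).card = m}

variable {a N k m : ℕ} {F : Finset (ℕ × ℕ)}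

theorem mem_breaks {b : ℕ} :
    b ∈ breaks a N F ↔ (a < b ∧ b ≤ N) ∧ ∀ p ∈ F, b ≤ p.1 ∨ p.2 ≤ b := by
  simp [breaks]

theorem mem_arcSetsGE :
    F ∈ arcSetsGE N a k m ↔ IsNoncrossing a N F ∧ F.card = k ∧ m ≤ (breaks a N F).card := by
  classical
  simp only [arcSetsGE, Finset.mem_filter, Finset.mem_powerset, and_iff_right_iff_imp]
  rintro ⟨h, -⟩ p hp
  have := h.bounds p hp
  simp only [Finset.mem_product, Finset.mem_range]
  omega

theorem mem_arcSets :
    F ∈ arcSets N a k m ↔ IsNoncrossing a N F ∧ F.card = k ∧ (breaks a N F).card = m := by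
  rw [arcSets, Finset.mem_filter, mem_arcSetsGE]
  constructor
  · rintro ⟨⟨h1, h2, -⟩, h3⟩
    exact ⟨h1, h2, h3⟩
  · rintro ⟨h1, h2, h3⟩
    exact ⟨⟨h1, h2, h3.ge⟩, h3⟩

theorem card_arcSetsGE (N a k m : ℕ) :
    (arcSetsGE N a k m).card = (arcSets N a k m).card + (arcSetsGE N a k (m + 1)).card := by
  rw [← Finset.card_filter_add_card_filter_not (s := arcSetsGE N a k m)
    (fun F => (breaks a N F).card = m), arcSets]
  congr 2
  ext F
  rw [Finset.mem_filter, mem_arcSetsGE, mem_arcSetsGE]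
  constructor
  · rintro ⟨⟨h1, h2, h3⟩, h4⟩
    exact ⟨h1, h2, by omega⟩
  · rintro ⟨h1, h2, h3⟩
    exact ⟨⟨h1, h2, by omega⟩, by omega⟩

theorem breaks_succ (h : IsNoncrossing (a + 1) N F) (ha : a < N) :
    breaks a N F = insert (a + 1) (breaks (a + 1) N F) := by
  ext b
  rw [Finset.mem_insert, mem_breaks, mem_breaks]
  constructor
  · rintro ⟨h1, h2⟩
    by_cases hb : b = a + 1
    · exact Or.inl hb
    · exact Or.inr ⟨by omega, h2⟩
  · rintro (rfl | ⟨h1, h2⟩)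
    · exact ⟨by omega, fun p hp => Or.inl (h.bounds p hp).1⟩
    · exact ⟨by omega, h2⟩

theorem card_breaks_succ (h : IsNoncrossing (a + 1) N F) (ha : a < N) :
    (breaks a N F).card = (breaks (a + 1) N F).card + 1 := by
  rw [breaks_succ h ha, Finset.card_insert_of_notMem]
  simp [mem_breaks]

/-- The arcs that start at the left end of the interval have a longest one among them. -/
theorem exists_longest (h : ∃ p ∈ F, p.1 = a) :
    ∃ c, (a, c) ∈ F ∧ ∀ x, (a, x) ∈ F → x ≤ c := by
  obtain ⟨p, hp, rfl⟩ := h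
  obtain ⟨q, hq, hmax⟩ := Finset.exists_max_image {q ∈ F | q.1 = p.1} Prod.snd
    ⟨p, by simp [hp]⟩
  rw [Finset.mem_filter] at hq
  refine ⟨q.2, ?_, fun x hx => hmax (p.1, x) (by simp [hx])⟩
  rw [← hq.2]
  exact hq.1

theorem IsNoncrossing.longest_mem_breaks (h : IsNoncrossing a N F) {c : ℕ} (hc : (a, c) ∈ F)
    (hmax : ∀ x, (a, x) ∈ F → x ≤ c) : c ∈ breaks a N F := by
  have hb := h.bounds _ hc
  simp only at hb
  refine mem_breaks.2 ⟨by omega, fun p hp => ?_⟩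
  have hpb := h.bounds p hp
  rcases hpb.1.eq_or_lt with h1 | h1
  · right
    apply hmax
    rw [h1]
    exact hp
  · by_contra! hcon
    have := h.nested _ hc p hp h1 hcon.1
    simp only at this
    omega

/-- If all arcs at `a` end before `c`, then the set of arcs has a break before `c`. -/
theorem IsNoncrossing.exists_break_lt (h : IsNoncrossing a N F) {c : ℕ} (hac : a + 2 ≤ c)
    (hcN : c ≤ N) (hF : ∀ x, (a, x) ∈ F → x < c) : ∃ b ∈ breaks a N F, b < c := by
  by_cases hs : ∃ p ∈ F, p.1 = a
  · obtain ⟨d, hd, hmax⟩ := exists_longest hs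
    exact ⟨d, h.longest_mem_breaks hd hmax, hF d hd⟩
  · push Not at hs
    refine ⟨a + 1, mem_breaks.2 ⟨by omega, fun p hp => Or.inl ?_⟩, by omega⟩
    have := (h.bounds p hp).1
    have := hs p hp
    omega

theorem IsNoncrossing.mono {G : Finset (ℕ × ℕ)} (h : IsNoncrossing a N F) (hG : G ⊆ F) :
    IsNoncrossing a N G :=
  ⟨fun p hp => h.bounds p (hG hp), fun p hp q hq => h.nested p (hG hp) q (hG hq)⟩

theorem breaks_insert {c : ℕ} : breaks a N (insert (a, c) F) = {b ∈ breaks a N F | c ≤ b} := by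
  ext b
  simp only [mem_breaks, Finset.mem_filter, Finset.forall_mem_insert]
  constructor
  · rintro ⟨h1, h2, h3⟩
    exact ⟨⟨h1, h3⟩, by omega⟩
  · rintro ⟨⟨h1, h2⟩, h3⟩
    exact ⟨h1, Or.inr h3, h2⟩

theorem IsNoncrossing.insert_break (h : IsNoncrossing a N F) {c : ℕ} (hc : c ∈ breaks a N F)
    (hac : a + 2 ≤ c) : IsNoncrossing a N (insert (a, c) F) := by
  rw [mem_breaks] at hc
  constructor
  · rw [Finset.forall_mem_insert]
    exact ⟨⟨le_rfl, hac, hc.1.2⟩, h.bounds⟩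
  · rw [Finset.forall_mem_insert]
    refine ⟨fun q hq h1 h2 => ?_, fun p hp q hq h1 h2 => ?_⟩
    · rw [Finset.mem_insert] at hq
      rcases hq with rfl | hq
      · exact le_rfl
      · have := hc.2 q hq
        simp only at h2 ⊢
        omega
    · rw [Finset.mem_insert] at hq
      rcases hq with rfl | hq
      · have := (h.bounds p hp).1
        simp only at h1
        omega
      · exact h.nested p hp q hq h1 h2

/-! ### The recurrence -/

/-- A finite set of naturals with more than `m ≥ 1` elements has a non-minimal element with exactly
`m` elements above it (itself included). -/
theorem exists_card_filter_ge {B : Finset ℕ} (hm : 1 ≤ m) (hB : m + 1 ≤ B.card) :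
    ∃ c ∈ B, {b ∈ B | c ≤ b}.card = m ∧ ∃ d ∈ B, d < c := by
  induction B using Finset.induction_on_min with
  | empty => simp at hB
  | insert x B hx ih =>
    have hxB : x ∉ B := fun hmem => lt_irrefl _ (hx x hmem)
    rw [Finset.card_insert_of_notMem hxB] at hB
    have key : ∀ c ∈ B, {b ∈ insert x B | c ≤ b} = {b ∈ B | c ≤ b} := by
      intro c hc
      rw [Finset.filter_insert, if_neg (not_le.2 (hx c hc))]
    rcases (Nat.le_of_succ_le_succ hB).eq_or_lt with h | h
    · have hne : B.Nonempty := Finset.card_pos.1 (by omega)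
      have hmem := B.min'_mem hne
      refine ⟨B.min' hne, Finset.mem_insert_of_mem hmem, ?_, x, Finset.mem_insert_self _ _,
        hx _ hmem⟩
      rw [key _ hmem, Finset.filter_true_of_mem fun b hb => B.min'_le b hb, h]
    · obtain ⟨c, hc, h1, d, hd, hdc⟩ := ih h
      exact ⟨c, Finset.mem_insert_of_mem hc, by rw [key c hc, h1], d,
        Finset.mem_insert_of_mem hd, hdc⟩

theorem eq_of_card_filter_ge_eq {B : Finset ℕ} {c d : ℕ} (hc : c ∈ B) (hd : d ∈ B)
    (h : {b ∈ B | c ≤ b}.card = {b ∈ B | d ≤ b}.card) : c = d := by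
  wlog hcd : c < d generalizing c d
  · rcases (not_lt.1 hcd).eq_or_lt with h1 | h1
    · exact h1.symm
    · exact (this hd hc h.symm h1).symm
  · exfalso
    refine h.not_gt (Finset.card_lt_card ⟨fun b hb => ?_, fun hsub => ?_⟩)
    · rw [Finset.mem_filter] at hb ⊢
      exact ⟨hb.1, hcd.le.trans hb.2⟩
    · have := hsub (Finset.mem_filter.2 ⟨hc, le_rfl⟩)
      exact (Finset.mem_filter.1 this).2.not_gt hcd

/-- Erasing the longest arc at `a` is a bijection onto the arc sets with more components. -/
theorem card_filter_start (N a k m : ℕ) :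
    {F ∈ arcSets N a (k + 1) (m + 1) | ∃ p ∈ F, p.1 = a}.card = (arcSetsGE N a k (m + 2)).card := by
  have hex : ∀ F ∈ {F ∈ arcSets N a (k + 1) (m + 1) | ∃ p ∈ F, p.1 = a},
      ∃ c, (a, c) ∈ F ∧ ∀ x, (a, x) ∈ F → x ≤ c :=
    fun F hF => exists_longest (Finset.mem_filter.1 hF).2
  choose! c hc hmax using hex
  have hbr : ∀ F ∈ {F ∈ arcSets N a (k + 1) (m + 1) | ∃ p ∈ F, p.1 = a},
      breaks a N F = {b ∈ breaks a N (F.erase (a, c F)) | c F ≤ b} := by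
    intro F hF
    rw [← breaks_insert, Finset.insert_erase (hc F hF)]
  have hcm : ∀ F ∈ {F ∈ arcSets N a (k + 1) (m + 1) | ∃ p ∈ F, p.1 = a},
      c F ∈ breaks a N (F.erase (a, c F)) := by
    intro F hF
    have h := (mem_arcSets.1 (Finset.mem_filter.1 hF).1).1
    have := h.longest_mem_breaks (hc F hF) (hmax F hF)
    rw [hbr F hF] at this
    exact (Finset.mem_filter.1 this).1
  refine Finset.card_bij (fun F _ => F.erase (a, c F)) ?_ ?_ ?_
  · intro F hF
    obtain ⟨h1, h2, h3⟩ := mem_arcSets.1 (Finset.mem_filter.1 hF).1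
    have hb := h1.bounds _ (hc F hF)
    have h1' := h1.mono (F.erase_subset (a, c F))
    refine mem_arcSetsGE.2 ⟨h1', ?_, ?_⟩
    · rw [Finset.card_erase_of_mem (hc F hF), h2, Nat.add_sub_cancel]
    -- The remaining arcs at `a` end before `c F`, so some break lies before `c F`; the erased arc
    -- was hiding it.
    · obtain ⟨b, hb1, hb2⟩ := h1'.exists_break_lt hb.2.1 hb.2.2 (fun x hx => by
        rw [Finset.mem_erase] at hx
        refine lt_of_le_of_ne (hmax F hF x hx.2) fun h => hx.1 (by rw [h]))
      rw [hbr F hF] at h3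
      rw [show m + 2 = (m + 1) + 1 from rfl, ← h3, Nat.succ_le_iff]
      refine Finset.card_lt_card ⟨Finset.filter_subset _ _, fun hsub => ?_⟩
      exact (Finset.mem_filter.1 (hsub hb1)).2.not_gt hb2
  · intro F hF G hG hFG
    have hF3 := (mem_arcSets.1 (Finset.mem_filter.1 hF).1).2.2
    have hG3 := (mem_arcSets.1 (Finset.mem_filter.1 hG).1).2.2
    have hcG := hcm G hG
    rw [hbr F hF] at hF3
    rw [hbr G hG, ← hFG] at hG3
    rw [← hFG] at hcG
    -- Both endpoints are the break of the common erased set with exactly `m + 1` breaks at or after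
    -- it.
    have hcc := eq_of_card_filter_ge_eq (hcm F hF) hcG (hF3.trans hG3.symm)
    rw [← Finset.insert_erase (hc F hF), ← Finset.insert_erase (hc G hG), hFG, hcc]
  · intro F' hF'
    obtain ⟨h1, h2, h3⟩ := mem_arcSetsGE.1 hF'
    -- The earlier break `d` gives `a + 2 ≤ b`, so `(a, b)` is an admissible arc, and it lies
    -- strictly below `(a, b)`, which is therefore new.
    obtain ⟨b, hb, hbm, d, hd, hdb⟩ := exists_card_filter_ge (Nat.le_add_left 1 m) h3
    have hd' := mem_breaks.1 hd
    have hb' := mem_breaks.1 hb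
    have hnot : (a, b) ∉ F' := fun hmem => by
      have := hd'.2 _ hmem
      simp only at this
      omega
    have hmem : insert (a, b) F' ∈ {F ∈ arcSets N a (k + 1) (m + 1) | ∃ p ∈ F, p.1 = a} := by
      refine Finset.mem_filter.2 ⟨mem_arcSets.2 ⟨h1.insert_break hb (by omega), ?_, ?_⟩,
        (a, b), Finset.mem_insert_self _ _, rfl⟩
      · rw [Finset.card_insert_of_notMem hnot, h2]
      · rw [breaks_insert, hbm]
    refine ⟨_, hmem, ?_⟩
    have hcb : c (insert (a, b) F') = b := by
      apply le_antisymm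
      · have := hc _ hmem
        rw [Finset.mem_insert] at this
        rcases this with h | h
        · exact (Prod.ext_iff.1 h).2.le
        · have := hb'.2 _ h
          simp only at this
          omega
      · exact hmax _ hmem b (Finset.mem_insert_self _ _)
    simp only [hcb]
    exact Finset.erase_insert hnot

theorem card_arcSets_succ (ha : a < N) (k m : ℕ) :
    (arcSets N a (k + 1) (m + 1)).card =
      (arcSets N (a + 1) (k + 1) m).card + (arcSetsGE N a k (m + 2)).card := by
  rw [← card_filter_start, add_comm (Finset.card _), ← Finset.card_filter_add_card_filter_not
    (s := arcSets N a (k + 1) (m + 1)) (fun F => ∃ p ∈ F, p.1 = a)]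
  congr 2
  ext F
  rw [Finset.mem_filter, mem_arcSets, mem_arcSets]
  constructor
  · rintro ⟨⟨h1, h2, h3⟩, h4⟩
    have h : IsNoncrossing (a + 1) N F := by
      refine ⟨fun p hp => ?_, h1.nested⟩
      have := h1.bounds p hp
      have : p.1 ≠ a := fun h => h4 ⟨p, hp, h⟩
      omega
    rw [card_breaks_succ h ha] at h3
    exact ⟨h, h2, by omega⟩
  · rintro ⟨h1, h2, h3⟩
    refine ⟨⟨⟨fun p hp => ?_, h1.nested⟩, h2, by rw [card_breaks_succ h1 ha, h3]⟩, ?_⟩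
    · have := h1.bounds p hp
      omega
    · rintro ⟨p, hp, hpa⟩
      have := h1.bounds p hp
      omega

/-! ### Closed formulas -/

theorem card_arcSetsGE_zero (h : a + m ≤ N) : (arcSetsGE N a 0 m).card = 1 := by
  rw [Finset.card_eq_one]
  refine ⟨∅, ?_⟩
  ext F
  rw [mem_arcSetsGE, Finset.mem_singleton, Finset.card_eq_zero]
  refine ⟨fun h => h.2.1, ?_⟩
  rintro rfl
  refine ⟨⟨by simp, by simp⟩, rfl, ?_⟩
  simp only [breaks, Finset.notMem_empty, false_imp_iff, implies_true, Finset.filter_true,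
    Nat.card_Ioc]
  omega

/-- Any arc `p` hides the point `p.1 + 1`, so not all `N - a` points are breaks. -/
theorem arcSetsGE_eq_empty (h : N ≤ a + m) (k : ℕ) : arcSetsGE N a (k + 1) m = ∅ := by
  refine Finset.eq_empty_of_forall_notMem fun F hF => ?_
  obtain ⟨h1, h2, h3⟩ := mem_arcSetsGE.1 hF
  obtain ⟨p, hp⟩ := Finset.card_pos.1 (show 0 < F.card by omega)
  have hb := h1.bounds p hp
  have : (breaks a N F).card < (Finset.Ioc a N).card := by
    refine Finset.card_lt_card ⟨Finset.filter_subset _ _, fun hsub => ?_⟩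
    have := (mem_breaks.1 (hsub (Finset.mem_Ioc.2 (show a < p.1 + 1 ∧ p.1 + 1 ≤ N by omega)))).2 p hp
    omega
  rw [Nat.card_Ioc] at this
  omega

theorem last_mem_breaks (h : IsNoncrossing a N F) (ha : a < N) : N ∈ breaks a N F :=
  mem_breaks.2 ⟨⟨ha, le_rfl⟩, fun p hp => Or.inr (h.bounds p hp).2.2⟩

theorem arcSets_zero_eq_empty (h : a < N) (k : ℕ) : arcSets N a k 0 = ∅ := by
  refine Finset.eq_empty_of_forall_notMem fun F hF => ?_
  obtain ⟨h1, -, h3⟩ := mem_arcSets.1 hF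
  have := Finset.card_pos.2 ⟨N, last_mem_breaks h1 h⟩
  omega

/-- Induction on `m` through the recurrence, with `s = N - a - m - 1` fixed: the hypothesis supplies
the term with one arc fewer. -/
theorem card_arcSets_of_card_arcSetsGE
    (hGE : ∀ a m s : ℕ, N = a + (m + 1) + s →
      (m + 1 + s + k) * (k + 1) * (arcSetsGE N a k (m + 1)).card =
        s.choose k * (m + 1 + s + k).choose k * (m * k + m + 1 + s)) (m : ℕ) :
    ∀ a s : ℕ, N = a + m + (s + 1) →
      (m + s + k + 2) * (arcSets N a (k + 1) m).card =
        m * (m + s + k + 2).choose (k + 1) * s.choose k := by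
  induction m with
  | zero =>
    intro a s hN
    rw [arcSets_zero_eq_empty (by omega)]
    simp
  | succ m ih =>
    intro a s hN
    have h1 := ih (a + 1) s (by omega)
    have h2 := hGE a (m + 1) s (by omega)
    rw [card_arcSets_succ (by omega)]
    generalize (arcSets N (a + 1) (k + 1) m).card = A at *
    generalize (arcSetsGE N a k (m + 1 + 1)).card = C at *
    have e1 := Nat.choose_mul_succ_eq (m + s + k + 2) (k + 1)
    have e2 := Nat.choose_succ_right_eq (m + s + k + 2) k
    rw [show m + s + k + 2 + 1 - (k + 1) = m + s + 2 by omega] at e1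
    rw [show m + s + k + 2 - k = m + s + 2 by omega] at e2
    rw [show m + 1 + 1 + s + k = m + s + k + 2 by omega] at h2
    rw [show m + 1 + s + k + 2 = m + s + k + 2 + 1 by omega]
    generalize (m + s + k + 2).choose (k + 1) = X at *
    generalize (m + s + k + 2).choose k = Y at *
    generalize (m + s + k + 2 + 1).choose (k + 1) = Z at *
    generalize s.choose k = W at *
    have hY : (Y : ℚ) = X * (k + 1) / (m + s + 2) := by
      field_simp
      exact_mod_cast e2.symm
    have hZ : (Z : ℚ) = X * (m + s + k + 3) / (m + s + 2) := by
      field_simp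
      have : (X * (m + s + k + 2 + 1) : ℚ) = Z * (m + s + 2) := by exact_mod_cast e1
      linarith
    have hA : (A : ℚ) = m * X * W / (m + s + k + 2) := by
      field_simp
      exact_mod_cast (by rw [mul_comm, h1] : A * (m + s + k + 2) = m * X * W)
    have hC : (C : ℚ) = W * Y * ((m + 1) * k + (m + 1) + 1 + s) / ((m + s + k + 2) * (k + 1)) := by
      field_simp
      have : ((m + s + k + 2) * (k + 1) * C : ℚ) = W * Y * ((m + 1) * k + (m + 1) + 1 + s) := by
        exact_mod_cast h2
      linear_combination this
    have : ((m + s + k + 2 + 1) * (A + C) : ℚ) = (m + 1) * Z * W := by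
      rw [hA, hC, hZ, hY]
      field_simp
      ring
    exact_mod_cast this

/-- The number of sets of `k` noncrossing arcs with more than `m` components. -/
theorem card_arcSetsGE_eq (N k : ℕ) : ∀ a m s : ℕ, N = a + (m + 1) + s →
    (m + 1 + s + k) * (k + 1) * (arcSetsGE N a k (m + 1)).card =
      s.choose k * (m + 1 + s + k).choose k * (m * k + m + 1 + s) := by
  induction k with
  | zero =>
    intro a m s hN
    rw [card_arcSetsGE_zero (by omega)]
    simp
  | succ k ih =>
    have hA := card_arcSets_of_card_arcSetsGE ih
    intro a m s
    induction s generalizing m with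
    | zero =>
      intro hN
      rw [arcSetsGE_eq_empty (by omega)]
      simp
    | succ s ihs =>
      intro hN
      have h1 := hA (m + 1) a s (by omega)
      have h2 := ihs (m + 1) (by omega)
      have e := Nat.choose_succ_right_eq s k
      rw [card_arcSetsGE, Nat.choose_succ_succ]
      rw [show m + 1 + s + k + 2 = m + s + k + 3 by omega] at h1
      rw [show m + 1 + 1 + s + (k + 1) = m + s + k + 3 by omega] at h2
      rw [show m + 1 + (s + 1) + (k + 1) = m + s + k + 3 by omega]
      generalize (arcSets N a (k + 1) (m + 1)).card = A at *
      generalize (arcSetsGE N a (k + 1) (m + 1 + 1)).card = C at *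
      generalize (m + s + k + 3).choose (k + 1) = X at *
      -- For `s < k` the rational factor `s - k` differs from the truncated one, but both binomials
      -- vanish.
      have e' : (s.choose (k + 1) * (k + 1) : ℚ) = s.choose k * (s - k) := by
        rcases le_total k s with h | h
        · rw [← Nat.cast_sub h]
          exact_mod_cast e
        · rcases h.eq_or_lt with rfl | h
          · simp
          · simp [Nat.choose_eq_zero_of_lt h, Nat.choose_eq_zero_of_lt (h.trans (Nat.lt_succ_self _))]
      generalize s.choose (k + 1) = U at *
      generalize s.choose k = W at *
      have h1' : ((m + s + k + 3) * A : ℚ) = (m + 1) * X * W := by exact_mod_cast h1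
      have h2' : ((m + s + k + 3) * (k + 1 + 1) * C : ℚ) =
          U * X * ((m + 1) * (k + 1) + (m + 1) + 1 + s) := by exact_mod_cast h2
      have : ((m + s + k + 3) * (k + 1 + 1) * (A + C) : ℚ) =
          (W + U) * X * (m * (k + 1) + m + 1 + (s + 1)) := by
        linear_combination (k + 2 : ℚ) * h1' + h2' + X * e'
      exact_mod_cast this

/-! ### Orientation and intersecting segments -/

section Plane

variable {a b c d : Plane}

theorem orient_rotate (a b c : Plane) : orient a b c = orient b c a := by
  simp only [orient]
  ring

theorem orient_swap (a b c : Plane) : orient b a c = -orient a b c := by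
  simp only [orient]
  ring

theorem orient_left (a b : Plane) : orient a b a = 0 := by
  simp [orient]

theorem orient_right (a b : Plane) : orient a b b = 0 := by
  simp only [orient]
  ring

theorem orient_combo (a b c d : Plane) {s t : ℝ} (h : s + t = 1) :
    orient a b (s • c + t • d) = s * orient a b c + t * orient a b d := by
  obtain rfl : t = 1 - s := by linarith
  simp only [orient, PiLp.add_apply, PiLp.smul_apply, smul_eq_mul]
  ring

theorem orient_of_mem_openSegment {x : Plane} (hx : x ∈ openSegment ℝ a b) :
    orient a b x = 0 := by
  obtain ⟨s, t, -, -, hst, rfl⟩ := hx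
  rw [orient_combo a b a b hst, orient_left, orient_right]
  simp

theorem disjoint_openSegment_of_nonneg (hc : 0 ≤ orient a b c) (hd : 0 ≤ orient a b d)
    (hcd : 0 < orient a b c + orient a b d) :
    Disjoint (openSegment ℝ a b) (openSegment ℝ c d) := by
  rw [Set.disjoint_left]
  rintro x hx ⟨s, t, hs, ht, hst, rfl⟩
  have h := orient_of_mem_openSegment hx
  rw [orient_combo a b c d hst] at h
  have h1 := mul_nonneg hs.le hc
  have h2 := mul_nonneg ht.le hd
  have h3 : orient a b c = 0 := (mul_eq_zero.1 (by linarith)).resolve_left hs.ne'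
  have h4 : orient a b d = 0 := (mul_eq_zero.1 (by linarith)).resolve_left ht.ne'
  linarith

theorem disjoint_openSegment_of_nonpos (hc : orient a b c ≤ 0) (hd : orient a b d ≤ 0)
    (hcd : orient a b c + orient a b d < 0) :
    Disjoint (openSegment ℝ a b) (openSegment ℝ c d) := by
  rw [openSegment_symm ℝ a b]
  apply disjoint_openSegment_of_nonneg <;> simp only [orient_swap a b] <;> linarith

theorem not_disjoint_openSegment (hc : orient a b c < 0) (hd : 0 < orient a b d)
    (ha : 0 < orient c d a) (hb : orient c d b < 0) :
    ¬ Disjoint (openSegment ℝ a b) (openSegment ℝ c d) := by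
  have hD : 0 < orient a b d - orient a b c := by linarith
  have hE : orient c d a - orient c d b = orient a b d - orient a b c := by
    simp only [orient]
    ring
  rw [Set.not_disjoint_iff]
  -- The intersection point: each end point is weighted by the distance of the opposite one from the
  -- other line, up to a common factor.
  refine ⟨_, ⟨-orient c d b / (orient a b d - orient a b c),
      orient c d a / (orient a b d - orient a b c), div_pos (by linarith) hD, div_pos ha hD, ?_,
      rfl⟩,
    ⟨orient a b d / (orient a b d - orient a b c), -orient a b c / (orient a b d - orient a b c),
      div_pos hd hD, div_pos (by linarith) hD, ?_, ?_⟩⟩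
  · rw [← add_div, div_eq_one_iff_eq hD.ne', ← hE]
    ring
  · rw [← add_div, div_eq_one_iff_eq hD.ne']
    ring
  · have key : ∀ i, orient a b d * c i + -orient a b c * d i =
        -orient c d b * a i + orient c d a * b i := by
      intro i
      fin_cases i <;> simp only [orient, Fin.zero_eta, Fin.mk_one] <;> ring
    ext i
    simp only [PiLp.add_apply, PiLp.smul_apply, smul_eq_mul, div_mul_eq_mul_div, ← add_div, key]

end Plane

/-! ### Crossing diagonals of a convex polygon -/

section Polygon

variable {n : ℕ} {v : Fin (n + 1) → Plane}

theorem IsConvexPolygon.edge (hv : IsConvexPolygon v) {i m : ℕ} (hi : i < n) (hm : m ≤ n)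
    (h1 : m ≠ i) (h2 : m ≠ i + 1) :
    0 < orient (v (Fin.ofNat (n + 1) i)) (v (Fin.ofNat (n + 1) (i + 1)))
      (v (Fin.ofNat (n + 1) m)) := by
  have hne : ∀ l ≤ n, m ≠ l → Fin.ofNat (n + 1) m ≠ Fin.ofNat (n + 1) l := by
    intro l hl hml h
    have := congrArg Fin.val h
    rw [Fin.val_ofNat, Fin.val_ofNat, Nat.mod_eq_of_lt (by omega),
      Nat.mod_eq_of_lt (by omega)] at this
    exact hml this
  have hsucc : Fin.ofNat (n + 1) (i + 1) = Fin.ofNat (n + 1) i + 1 := by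
    ext
    simp [Fin.val_add]
  rw [hsucc]
  refine hv _ _ (hne i hi.le h1) ?_
  rw [← hsucc]
  exact hne (i + 1) hi h2

/-- Convexity is assumed only along sides; induction on `k` extends it to all triples by the
three-term Plücker relation for the vectors from `v i` to `v (i + 1)`, `v j`, `v k`, `v (k + 1)`. -/
theorem IsConvexPolygon.orient_pos_nat (hv : IsConvexPolygon v) {i j k : ℕ} (hij : i < j)
    (hjk : j + 1 ≤ k) (hk : k ≤ n) :
    0 < orient (v (Fin.ofNat (n + 1) i)) (v (Fin.ofNat (n + 1) j)) (v (Fin.ofNat (n + 1) k)) := by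
  induction k, hjk using Nat.le_induction with
  | base =>
    rw [orient_rotate]
    exact hv.edge (by omega) (by omega) (by omega) (by omega)
  | succ k hjk ih =>
    have hjk' := ih (by omega)
    rcases (Nat.succ_le_of_lt hij).eq_or_lt with h | h
    · rw [← h]
      exact hv.edge (by omega) hk (by omega) (by omega)
    · have h1 := hv.edge (i := i) (m := j) (by omega) (by omega) (by omega) (by omega)
      have h2 := hv.edge (i := i) (m := k) (by omega) (by omega) (by omega) (by omega)
      have h3 := hv.edge (i := i) (m := k + 1) (by omega) (by omega) (by omega) (by omega)
      have h4 := hv.edge (i := k) (m := i) (by omega) (by omega) (by omega) (by omega)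
      rw [← orient_rotate] at h4
      generalize v (Fin.ofNat (n + 1) (i + 1)) = u at *
      generalize v (Fin.ofNat (n + 1) (k + 1)) = z at *
      generalize v (Fin.ofNat (n + 1) i) = o at *
      generalize v (Fin.ofNat (n + 1) j) = x at *
      generalize v (Fin.ofNat (n + 1) k) = y at *
      have key : orient o u y * orient o x z =
          orient o u x * orient o y z + orient o u z * orient o x y := by
        simp only [orient]
        ring
      refine pos_of_mul_pos_right (a := orient o u y) ?_ h2.le
      rw [key]
      positivity

theorem IsConvexPolygon.orient_pos (hv : IsConvexPolygon v) {i j k : Fin (n + 1)} (hij : i < j)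
    (hjk : j < k) : 0 < orient (v i) (v j) (v k) := by
  have := hv.orient_pos_nat (i := i) (j := j) (k := k) hij hjk (Nat.le_of_lt_succ k.2)
  simpa only [Fin.ofNat_val_eq_self] using this

theorem IsConvexPolygon.orient_neg_of_between (hv : IsConvexPolygon v) {i j m : Fin (n + 1)}
    (him : i < m) (hmj : m < j) : orient (v i) (v j) (v m) < 0 := by
  have := hv.orient_pos him hmj
  rw [orient_rotate, orient_rotate, orient_swap] at this
  linarith

theorem IsConvexPolygon.orient_pos_of_outside (hv : IsConvexPolygon v) {i j m : Fin (n + 1)}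
    (hij : i < j) (hm : m < i ∨ j < m) : 0 < orient (v i) (v j) (v m) := by
  rcases hm with hm | hm
  · rw [← orient_rotate]
    exact hv.orient_pos hm hij
  · exact hv.orient_pos hij hm

theorem IsConvexPolygon.not_disjoint_of_crossing (hv : IsConvexPolygon v) {i j p q : Fin (n + 1)}
    (h1 : i < p) (h2 : p < j) (h3 : j < q) :
    ¬ Disjoint (openSegment ℝ (v i) (v j)) (openSegment ℝ (v p) (v q)) :=
  not_disjoint_openSegment (hv.orient_neg_of_between h1 h2)
    (hv.orient_pos_of_outside (h1.trans h2) (Or.inr h3))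
    (hv.orient_pos_of_outside (h2.trans h3) (Or.inl h1)) (hv.orient_neg_of_between h2 h3)

/-- Without interlacing, `v p` and `v q` lie on one closed side of the line through `v i` and `v j`,
and not both on it. -/
theorem IsConvexPolygon.disjoint_of_not_crossing (hv : IsConvexPolygon v) {i j p q : Fin (n + 1)}
    (hij : i < j) (hpq : p < q) (hne : i ≠ p ∨ j ≠ q) (h1 : ¬ (i < p ∧ p < j ∧ j < q))
    (h2 : ¬ (p < i ∧ i < q ∧ q < j)) :
    Disjoint (openSegment ℝ (v i) (v j)) (openSegment ℝ (v p) (v q)) := by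
  have hin : ∀ m : Fin (n + 1), i ≤ m → m ≤ j →
      (orient (v i) (v j) (v m) < 0 ∨ (m = i ∨ m = j) ∧ orient (v i) (v j) (v m) = 0) := by
    intro m him hmj
    rcases him.eq_or_lt with rfl | him
    · exact Or.inr ⟨Or.inl rfl, orient_left _ _⟩
    rcases hmj.eq_or_lt with rfl | hmj
    · exact Or.inr ⟨Or.inr rfl, orient_right _ _⟩
    exact Or.inl (hv.orient_neg_of_between him hmj)
  have hout : ∀ m : Fin (n + 1), m ≤ i ∨ j ≤ m →
      (0 < orient (v i) (v j) (v m) ∨ (m = i ∨ m = j) ∧ orient (v i) (v j) (v m) = 0) := by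
    rintro m (hm | hm) <;> rcases hm.eq_or_lt with rfl | hm
    · exact Or.inr ⟨Or.inl rfl, orient_left _ _⟩
    · exact Or.inl (hv.orient_pos_of_outside hij (Or.inl hm))
    · exact Or.inr ⟨Or.inr rfl, orient_right _ _⟩
    · exact Or.inl (hv.orient_pos_of_outside hij (Or.inr hm))
  by_cases hcase : (i ≤ p ∧ p ≤ j) ∧ i ≤ q ∧ q ≤ j
  · rcases hin p hcase.1.1 hcase.1.2 with hp | ⟨hp, hp0⟩ <;>
      rcases hin q hcase.2.1 hcase.2.2 with hq | ⟨hq, hq0⟩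
    · exact disjoint_openSegment_of_nonpos hp.le hq.le (by linarith)
    · exact disjoint_openSegment_of_nonpos hp.le hq0.le (by linarith)
    · exact disjoint_openSegment_of_nonpos hp0.le hq.le (by linarith)
    · omega
  · rcases hout p (by omega) with hp | ⟨hp, hp0⟩ <;>
      rcases hout q (by omega) with hq | ⟨hq, hq0⟩
    · exact disjoint_openSegment_of_nonneg hp.le hq.le (by linarith)
    · exact disjoint_openSegment_of_nonneg hp.le hq0.ge (by linarith)
    · exact disjoint_openSegment_of_nonneg hp0.ge hq.le (by linarith)
    · omega

theorem isDiagonal_iff (hn : 2 ≤ n) (d : Fin (n + 1) × Fin (n + 1)) :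
    IsDiagonal d ↔ (d.1 : ℕ) + 2 ≤ d.2 ∧ ¬ ((d.1 : ℕ) = 0 ∧ (d.2 : ℕ) = n) := by
  obtain ⟨i, j⟩ := d
  simp only [IsDiagonal, ne_eq, Fin.ext_iff, Fin.val_add_one, Fin.lt_def, Fin.val_last]
  split_ifs <;> omega

end Polygon

/-! ### Dissections and parenthesizations as arc sets -/

section Bijections

variable {n : ℕ}

/-- A diagonal as an arc on `[0, n]`. -/
def diagonalArc (n : ℕ) : Fin (n + 1) × Fin (n + 1) ↪ ℕ × ℕ where
  toFun d := (d.1, d.2)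
  inj' d e h := by
    simp only [Prod.mk.injEq] at h
    exact Prod.ext (Fin.ext h.1) (Fin.ext h.2)

@[simp]
theorem diagonalArc_apply (d : Fin (n + 1) × Fin (n + 1)) :
    diagonalArc n d = ((d.1 : ℕ), (d.2 : ℕ)) :=
  rfl

/-- A pair of parentheses as the arc joining the two gaps of the list at which it is inserted. -/
def parenthesesArc (n : ℕ) : Fin n × Fin n ↪ ℕ × ℕ where
  toFun p := (p.1, p.2 + 1)
  inj' p q h := by
    simp only [Prod.mk.injEq, Nat.add_right_cancel_iff] at h
    exact Prod.ext (Fin.ext h.1) (Fin.ext h.2)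

@[simp]
theorem parenthesesArc_apply (p : Fin n × Fin n) :
    parenthesesArc n p = ((p.1 : ℕ), (p.2 : ℕ) + 1) :=
  rfl

theorem exists_map_eq {α β : Type*} [Fintype α] (f : α ↪ β) {F : Finset β}
    (h : ∀ y ∈ F, ∃ x, f x = y) : ∃ S : Finset α, S.map f = F := by
  classical
  refine ⟨Finset.univ.filter fun x => f x ∈ F, ?_⟩
  ext y
  simp only [Finset.mem_map, Finset.mem_filter, Finset.mem_univ, true_and]
  constructor
  · rintro ⟨x, hx, rfl⟩
    exact hx
  · intro hy
    obtain ⟨x, rfl⟩ := h y hy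
    exact ⟨x, hy, rfl⟩

theorem ncard_eq_card_of_map {α β : Type*} [Fintype α] (f : α ↪ β) {P : Finset α → Prop}
    {T : Finset (Finset β)} (hT : ∀ F ∈ T, ∀ y ∈ F, ∃ x, f x = y)
    (hP : ∀ S : Finset α, P S ↔ S.map f ∈ T) : {S | P S}.ncard = T.card := by
  rw [← Set.ncard_image_of_injective _ (Finset.map_injective f), ← Set.ncard_coe_finset]
  congr 1
  ext F
  simp only [Set.mem_image, Set.mem_ofPred_eq, Finset.mem_coe, hP]
  constructor
  · rintro ⟨S, hS, rfl⟩
    exact hS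
  · intro hF
    obtain ⟨S, rfl⟩ := exists_map_eq f (hT F hF)
    exact ⟨S, hF, rfl⟩

theorem IsNoncrossing.card_breaks_eq_one_iff {N : ℕ} {F : Finset (ℕ × ℕ)} (hN : 2 ≤ N)
    (h : IsNoncrossing 0 N F) : (breaks 0 N F).card = 1 ↔ (0, N) ∈ F := by
  have hlast := last_mem_breaks h (by omega)
  constructor
  · intro h1
    by_contra hmem
    obtain ⟨b, hb, hbN⟩ := h.exists_break_lt (c := N) (by omega) le_rfl (fun x hx => by
      refine lt_of_le_of_ne (h.bounds _ hx).2.2 ?_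
      rintro rfl
      exact hmem hx)
    exact hbN.ne (Finset.card_le_one.1 h1.le b hb N hlast)
  · intro hmem
    rw [Finset.card_eq_one]
    refine ⟨N, Finset.eq_singleton_iff_unique_mem.2 ⟨hlast, fun b hb => ?_⟩⟩
    rw [mem_breaks] at hb
    have := hb.2 _ hmem
    simp only at this
    omega

theorem IsConvexPolygon.isDissection_iff {v : Fin (n + 1) → Plane} (hv : IsConvexPolygon v)
    (hn : 2 ≤ n) (S : Finset (Fin (n + 1) × Fin (n + 1))) :
    IsDissection v S ↔
      IsNoncrossing 0 n (S.map (diagonalArc n)) ∧ (0, n) ∉ S.map (diagonalArc n) := by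
  constructor
  · rintro ⟨h1, h2⟩
    refine ⟨⟨?_, ?_⟩, ?_⟩
    · simp only [Finset.forall_mem_map]
      intro d hd
      have := (isDiagonal_iff hn d).1 (h1 d hd)
      exact ⟨Nat.zero_le _, this.1, Nat.le_of_lt_succ d.2.2⟩
    · simp only [Finset.forall_mem_map]
      intro d hd e he hde hed
      by_contra! hcon
      refine hv.not_disjoint_of_crossing hde hed hcon (h2 d hd e he ?_)
      rintro rfl
      exact lt_irrefl _ hde
    · rw [Finset.mem_map]
      rintro ⟨d, hd, hd0⟩
      have := (isDiagonal_iff hn d).1 (h1 d hd)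
      simp only [diagonalArc_apply, Prod.mk.injEq] at hd0
      omega
  · rintro ⟨⟨h1, h2⟩, h3⟩
    simp only [Finset.forall_mem_map, diagonalArc_apply] at h1 h2
    refine ⟨fun d hd => ?_, fun d hd e he hde => ?_⟩
    · refine (isDiagonal_iff hn d).2 ⟨(h1 d hd).2.1, fun h => h3 ?_⟩
      exact Finset.mem_map.2 ⟨d, hd, Prod.ext h.1 h.2⟩
    · have hdb := h1 d hd
      have heb := h1 e he
      refine hv.disjoint_of_not_crossing (by omega) (by omega) ?_ ?_ ?_
      · by_contra! hcon
        exact hde (Prod.ext hcon.1 hcon.2)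
      · rintro ⟨h4, h5, h6⟩
        exact (h2 d hd e he h4 h5).not_gt h6
      · rintro ⟨h4, h5, h6⟩
        exact (h2 e he d hd h4 h5).not_gt h6

theorem numDissections_eq {v : Fin (n + 1) → Plane} (hv : IsConvexPolygon v) (hn : 2 ≤ n)
    (r : ℕ) : numDissections v r = (arcSetsGE n 0 r 2).card := by
  refine ncard_eq_card_of_map (diagonalArc n) (fun F hF p hp => ?_) fun S => ?_
  · have := (mem_arcSetsGE.1 hF).1.bounds p hp
    exact ⟨(⟨p.1, by omega⟩, ⟨p.2, by omega⟩), rfl⟩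
  · rw [hv.isDissection_iff hn, mem_arcSetsGE, Finset.card_map, and_assoc]
    refine and_congr_right fun h => ?_
    rw [and_comm, ← h.card_breaks_eq_one_iff hn]
    have := Finset.card_pos.2 ⟨n, last_mem_breaks h (by omega)⟩
    omega

theorem enclosed_eq_univ_iff (p : Fin n × Fin n) :
    enclosed p = Finset.univ ↔ parenthesesArc n p = (0, n) := by
  obtain ⟨i, j⟩ := p
  have hi := i.2
  simp only [enclosed, parenthesesArc_apply, Prod.mk.injEq,
    Finset.eq_univ_iff_forall, Finset.mem_Icc, Fin.le_def]
  constructor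
  · intro h
    have h1 := h ⟨0, by omega⟩
    have h2 := h ⟨n - 1, by omega⟩
    dsimp only at h1 h2
    omega
  · intro h x
    omega

theorem nested_or_disjoint_iff {p q : Fin n × Fin n} (hp : p.1 ≤ p.2) (hq : q.1 ≤ q.2) :
    (enclosed p ⊆ enclosed q ∨ enclosed q ⊆ enclosed p ∨ Disjoint (enclosed p) (enclosed q)) ↔
      (p.1 < q.1 → q.1 ≤ p.2 → q.2 ≤ p.2) ∧ (q.1 < p.1 → p.1 ≤ q.2 → p.2 ≤ q.2) := by
  have hdisj : Disjoint (enclosed p) (enclosed q) ↔ p.2 < q.1 ∨ q.2 < p.1 := by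
    rw [Finset.disjoint_left]
    simp only [enclosed, Finset.mem_Icc]
    constructor
    · intro h
      have h1 := @h p.1
      have h2 := @h q.1
      omega
    · intro h x
      omega
  rw [hdisj, enclosed, enclosed, Finset.Icc_subset_Icc_iff hp, Finset.Icc_subset_Icc_iff hq]
  omega

theorem isParenthesization_iff (S : Finset (Fin n × Fin n)) :
    IsParenthesization S ↔
      IsNoncrossing 0 n (S.map (parenthesesArc n)) ∧ (0, n) ∈ S.map (parenthesesArc n) := by
  have hcard : ∀ p : Fin n × Fin n, 2 ≤ (enclosed p).card ↔ (p.1 : ℕ) + 2 ≤ p.2 + 1 := by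
    intro p
    rw [enclosed, Fin.card_Icc]
    omega
  have hfull : (∃ p ∈ S, enclosed p = Finset.univ) ↔ (0, n) ∈ S.map (parenthesesArc n) := by
    simp only [enclosed_eq_univ_iff, Finset.mem_map]
  rw [IsParenthesization, hfull]
  constructor
  · rintro ⟨h1, h2, h3⟩
    refine ⟨⟨?_, ?_⟩, h2⟩
    · simp only [Finset.forall_mem_map]
      exact fun p hp => ⟨Nat.zero_le _, (hcard p).1 (h1 p hp), p.2.2⟩
    · simp only [Finset.forall_mem_map, parenthesesArc_apply]
      intro p hp q hq hpq hqp
      have hp2 := (hcard p).1 (h1 p hp)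
      have hq2 := (hcard q).1 (h1 q hq)
      have := ((nested_or_disjoint_iff (by omega) (by omega)).1 (h3 p hp q hq)).1
      omega
  · rintro ⟨⟨h1, h3⟩, h2⟩
    simp only [Finset.forall_mem_map, parenthesesArc_apply] at h1 h3
    refine ⟨fun p hp => (hcard p).2 (h1 p hp).2.1, h2, fun p hp q hq => ?_⟩
    have hp2 := h1 p hp
    have hq2 := h1 q hq
    refine (nested_or_disjoint_iff (by omega) (by omega)).2 ⟨?_, ?_⟩
    · have := h3 p hp q hq
      omega
    · have := h3 q hq p hp
      omega

theorem numParenthesizations_eq (hn : 2 ≤ n) (k : ℕ) :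
    numParenthesizations n k = (arcSets n 0 k 1).card := by
  refine ncard_eq_card_of_map (parenthesesArc n) (fun F hF p hp => ?_) fun S => ?_
  · have := (mem_arcSets.1 hF).1.bounds p hp
    exact ⟨(⟨p.1, by omega⟩, ⟨p.2 - 1, by omega⟩), Prod.ext rfl (Nat.sub_add_cancel (by omega))⟩
  · rw [isParenthesization_iff, mem_arcSets, Finset.card_map, and_assoc]
    refine and_congr_right fun h => ?_
    rw [and_comm, ← h.card_breaks_eq_one_iff hn]

end Bijections

end KirkmanCayley

theorem mainTheorem1 (n k : ℕ) (hn : 2 ≤ n) (hk : 1 ≤ k)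
    (v : Fin (n + 1) → KirkmanCayley.Plane) (hv : KirkmanCayley.IsConvexPolygon v) :
    (KirkmanCayley.numDissections v (k - 1) : ℚ)
        = 1 / (k : ℚ) * ((n - 2).choose (k - 1) : ℚ) * ((n + k - 1).choose (k - 1) : ℚ) ∧
      KirkmanCayley.numParenthesizations n k = KirkmanCayley.numDissections v (k - 1) := by
  obtain ⟨k, rfl⟩ := Nat.exists_eq_add_of_le' hk
  obtain ⟨s, rfl⟩ := Nat.exists_eq_add_of_le' hn
  rw [KirkmanCayley.numDissections_eq hv hn, KirkmanCayley.numParenthesizations_eq hn,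
    Nat.add_sub_cancel, Nat.add_sub_cancel, ← Nat.add_assoc, Nat.add_sub_cancel]
  constructor
  · have h := KirkmanCayley.card_arcSetsGE_eq (s + 2) k 0 1 s (by omega)
    -- For at least two breaks the linear factor on the right equals the factor `s + 2 + k` on the
    -- left and cancels.
    rw [show 1 + 1 + s + k = s + 2 + k by omega, show 1 * k + 1 + 1 + s = s + 2 + k by omega,
      mul_assoc, mul_comm _ (s + 2 + k)] at h
    have h' := Nat.eq_of_mul_eq_mul_left (by omega) h
    have h'' : ((k + 1) * (KirkmanCayley.arcSetsGE (s + 2) 0 k (1 + 1)).card : ℚ) =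
        s.choose k * (s + 2 + k).choose k := by exact_mod_cast h'
    push_cast
    field_simp
    linear_combination h''
  · rw [KirkmanCayley.card_arcSets_succ (by omega), KirkmanCayley.arcSets_zero_eq_empty (by omega),
      Finset.card_empty, Nat.zero_add]
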